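/- All graphs are finite and simple. For a graph $G$ and $X \subseteq V(G)$, let $G|X$ denote the subgraph of $G$ induced by $X$, and for a graph $F$ say that $G$ is $F$-free if no induced subgraph of $G$ is isomorphic to $F$. Given graphs $L, M$, a graph $G$ is $\{L,M\}$-split if $V(G) = X \cup Y$ for some sets $X, Y$ such that $G|X$ is $L$-free and $G|Y$ is $M$-free. For an integer $P \ge 0$, a graph $G$ admits an $(\{L,M\},P)$-partition if $V(G) = X_1 \cup \dots \cup X_P$ for some sets $X_1,\dots,X_P$ such that for every $i \in \{1,\dots,P\}$, either $|X_i| = 1$, or $G|X_i$ is $L$-free, or $G|X_i$ is $M$-free. Let $L$ and $M$ be graphs, each with at least one edge. Then for all non-negative integers $r, k$ there is a graph $G$ such that 1. for every $S \subseteq V(G)$ with $|S| \le r$, the graph $G|S$ is $\{L,M\}$-split, and 2. $G$ admits no $(\{L,M\},k)$-partition. -/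

import Mathlib

open scoped SimpleGraph

universe u v

/-- `G` is `F`-free: no induced subgraph of `G` is isomorphic to `F`. -/
def IndFree {U : Type u} {V : Type v} (F : SimpleGraph U) (G : SimpleGraph V) : Prop :=
  ¬ F ⊴ G

/-- `G` is `{L, M}`-split: `V(G) = X ∪ Y` where `G|X` is `L`-free and `G|Y` is `M`-free. -/
def IsSplitPair {U W : Type u} {V : Type v} (L : SimpleGraph U) (M : SimpleGraph W)
    (G : SimpleGraph V) : Prop :=
  ∃ X Y : Set V, X ∪ Y = Set.univ ∧ IndFree L (G.induce X) ∧ IndFree M (G.induce Y)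

/-- `G` admits an `(𝓕, P)`-partition: `V(G) = X₁ ∪ ⋯ ∪ X_P` where, for every `i`,
either `|Xᵢ| = 1` or `G|Xᵢ` is `F`-free for some `F ∈ 𝓕`. A set of graphs is a set of pairs
consisting of a vertex type and a graph on it. -/
def AdmitsPartition {V : Type v} (𝓕 : Set (Σ U : Type u, SimpleGraph U)) (P : ℕ)
    (G : SimpleGraph V) : Prop :=
  ∃ X : Fin P → Set V, (⋃ i, X i) = Set.univ ∧
    ∀ i, (X i).ncard = 1 ∨ ∃ F ∈ 𝓕, IndFree F.2 (G.induce (X i))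

/-!
Call a graph `b`-tree-like if it can be assembled from graphs on at most `b` vertices by repeatedly
gluing along at most one vertex. This property passes to induced subgraphs and disjoint unions, and
`1`-tree-like graphs have no edges. Let `b + 1` be the least number for which both `L` and `M` are
tree-like; then `b ≥ 1`, and one of them is not `b`-tree-like.

A `(b + 1)`-tree-like graph has a stable set that meets every piece of size `b + 1`, chosen piece by
piece (`IsTreeLike.exists_stable`). Its complement is `b`-tree-like, hence free of whichever of `L`
and `M` is not, while the stable set is free of the other, which has an edge. So every
`(b + 1)`-tree-like graph is `{L, M}`-split (`isSplitPair_of_isTreeLike`).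

Now take a hypergraph whose edges have as many vertices as the disjoint union of `L` and `M`, in
which every small vertex set spans a hyperforest and every colouring with few colours has a
monochromatic edge (`existsSparseChromatic`). Placing a copy of the disjoint union on every edge
gives `G`: small sets of vertices induce `(b + 1)`-tree-like graphs, and one part of any cover by
`k` sets contains both `L` and `M`.

The hypergraph comes from the partite amalgamation of Nešetřil and Rödl, by induction on the size
`r` of the sets that must span hyperforests. Starting from disjoint edges distributed over many
parts, one treats the parts in turn: many copies are taken, and the current part of each copy is
identified with an edge of a hypergraph on `Y` that is good for `r`. A set of `r + 1` vertices inside `Y` spans nothing, and any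
other one has a trace of at most `r` vertices on `Y`, whose tree structure organises the copies
(`PartiteSystem.locallyHyperforest_amalgam`).
-/

open Set Function

/-! ### Hyperforests -/

/-- `IsHyperforest e S` says that the hypergraph with edges `e i`, restricted to the vertex set `S`,
is a hyperforest: it can be assembled from single vertices and from parts of single edges by
repeatedly gluing two pieces along at most one vertex. -/
inductive IsHyperforest {I V : Type*} (e : I → Set V) : Set V → Prop
  | subsingleton {S : Set V} (h : S.Subsingleton) : IsHyperforest e S
  | edge {S : Set V} (i : I) (h : S ⊆ e i) (h' : ∀ j, j ≠ i → (e j ∩ S).Subsingleton) :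
      IsHyperforest e S
  | glue {A B : Set V} (h : (A ∩ B).Subsingleton)
      (h' : ∀ i, e i ∩ (A ∪ B) ⊆ A ∨ e i ∩ (A ∪ B) ⊆ B)
      (hA : IsHyperforest e A) (hB : IsHyperforest e B) : IsHyperforest e (A ∪ B)

/-- Every set of at most `r` vertices spans a hyperforest. For `r ≥ 2` this implies that two
distinct edges share at most one vertex, and in general it excludes short cycles. The
definition is meant for finite `V`, since `Set.ncard` vanishes on infinite sets. -/
def LocallyHyperforest {I V : Type*} (e : I → Set V) (r : ℕ) : Prop :=
  ∀ S : Set V, S.ncard ≤ r → IsHyperforest e S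

namespace IsHyperforest

variable {I I' V V' : Type*} {e : I → Set V} {e' : I' → Set V'} {S : Set V}

/-- Distinct edges meet in at most one vertex inside a hyperforest. -/
theorem subsingleton_inter (h : IsHyperforest e S) {i j : I} (hij : i ≠ j) :
    (e i ∩ e j ∩ S).Subsingleton := by
  induction h with
  | subsingleton h => exact h.anti inter_subset_right
  | edge l h h' =>
    by_cases hi : i = l
    · exact (h' j (fun hj => hij (hi.trans hj.symm))).anti fun x hx => ⟨hx.1.2, hx.2⟩
    · exact (h' i hi).anti fun x hx => ⟨hx.1.1, hx.2⟩
  | glue h h' _ _ ihA ihB =>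
    rcases h' i with h' | h'
    · exact ihA.anti fun x hx => ⟨hx.1, h' ⟨hx.1.1, hx.2⟩⟩
    · exact ihB.anti fun x hx => ⟨hx.1, h' ⟨hx.1.1, hx.2⟩⟩

/-- Hyperforests are carried along an injection that maps edges to edges, provided that every
further edge of the target meets its range in at most one vertex. -/
theorem image (h : IsHyperforest e S) {f : V → V'} (hf : Injective f) (ι : I → I')
    (hι : ∀ i, e' (ι i) = f '' e i)
    (hcov : ∀ j, (∃ i, ι i = j) ∨ (e' j ∩ range f).Subsingleton) :
    IsHyperforest e' (f '' S) := by
  induction h with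
  | subsingleton h => exact .subsingleton (h.image f)
  | edge i h h' =>
    refine .edge (ι i) (hι i ▸ image_mono h) fun j hj => ?_
    rcases hcov j with ⟨l, rfl⟩ | hs
    · rw [hι, ← image_inter hf]
      exact (h' l (fun hl => hj (hl ▸ rfl))).image f
    · exact hs.anti (inter_subset_inter_right _ (image_subset_range f _))
  | @glue A B h h' _ _ ihA ihB =>
    rw [image_union]
    refine .glue ?_ (fun j => ?_) ihA ihB
    · rw [← image_inter hf]
      exact h.image f
    · rw [← image_union]
      rcases hcov j with ⟨l, rfl⟩ | hs
      · rw [hι, ← image_inter hf]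
        exact (h' l).imp (fun h => image_mono h) (fun h => image_mono h)
      · by_cases hA : e' j ∩ f '' (A ∪ B) ⊆ f '' A
        · exact .inl hA
        · right
          obtain ⟨x, ⟨hx, y, hy, rfl⟩, hxA⟩ := not_subset.1 hA
          have hyB : y ∈ B := hy.resolve_left fun h => hxA (mem_image_of_mem f h)
          intro z hz
          rw [hs ⟨hz.1, image_subset_range f _ hz.2⟩ ⟨hx, mem_range_self y⟩]
          exact mem_image_of_mem f hyB

/-- A set is a hyperforest if it is a disjoint union of hyperforests, the fibres of `p`, and no edge
meets two of these. -/
theorem of_fibers {J : Type*} [Finite V] (p : V → J) (S : Set V)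
    (hp : ∀ i, ∀ x ∈ e i ∩ S, ∀ y ∈ e i ∩ S, p x = p y)
    (hS : ∀ j, IsHyperforest e (S ∩ p ⁻¹' {j})) : IsHyperforest e S := by
  induction hn : S.ncard using Nat.strong_induction_on generalizing S with
  | _ n ih =>
  rcases S.eq_empty_or_nonempty with rfl | ⟨x, hx⟩
  · exact .subsingleton subsingleton_empty
  have hA : IsHyperforest e (S \ p ⁻¹' {p x}) := by
    refine ih _ ?_ _ (fun i y hy z hz => hp i y ⟨hy.1, hy.2.1⟩ z ⟨hz.1, hz.2.1⟩) (fun j => ?_) rfl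
    · rw [← hn]
      exact ncard_lt_ncard ⟨sdiff_subset, fun h => (h hx).2 rfl⟩
    · by_cases hj : j = p x
      · refine .subsingleton fun y hy => absurd (hy.2.trans hj) hy.1.2
      · convert hS j using 1
        ext y
        simp only [mem_inter_iff, mem_sdiff, mem_preimage, mem_singleton_iff]
        grind
  rw [← sdiff_union_inter S (p ⁻¹' {p x})]
  refine .glue ?_ (fun i => ?_) hA (hS _)
  · exact fun y hy => absurd hy.2.2 hy.1.2
  · rw [sdiff_union_inter]
    by_cases h : ∃ y ∈ e i ∩ S, p y = p x
    · obtain ⟨y, hy, hyx⟩ := h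
      exact .inr fun z hz => ⟨hz.2, (hp i z hz y hy).trans hyx⟩
    · exact .inl fun z hz => ⟨hz.2, fun hzx => h ⟨z, hz, hzx⟩⟩

end IsHyperforest

/-! ### Partite systems and their amalgamation -/

/-- A finite hypergraph with edges indexed by `I`, each edge being an injective copy `φ i` of `N`,
together with a map `c` to a set `A` of parts such that every edge meets every part at most once. -/
structure PartiteSystem (N A : Type) where
  /-- the vertices -/
  V : Type
  /-- the indices of the edges -/
  I : Type
  finV : Finite V
  finI : Finite I
  /-- the edges, as copies of `N` -/
  φ : I → N ↪ V
  /-- the part containing a vertex -/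
  c : V → A
  inj : ∀ i, Injective fun x => c (φ i x)

namespace PartiteSystem

attribute [instance] PartiteSystem.finV PartiteSystem.finI

variable {N A : Type}

/-- The edges of a partite system as sets of vertices. -/
def edge (P : PartiteSystem N A) (i : P.I) : Set P.V := range (P.φ i)

section Amalgam

variable (P : PartiteSystem N A) (a : A) {J Y : Type}
  (ρ : J → {x : P.V // P.c x = a} ↪ Y)

open Classical in
/-- The copy of `P` indexed by `g` inside the amalgam: part `a` is placed on the edge `ρ g`, and the
other parts are new vertices. -/
noncomputable def amalgamMap (g : J) (x : P.V) : Y ⊕ J × {x : P.V // P.c x ≠ a} :=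
  if h : P.c x = a then .inl (ρ g ⟨x, h⟩) else .inr (g, ⟨x, h⟩)

/-- The part of a vertex of the amalgam: all of `Y` is part `a`. -/
def amalgamPart : Y ⊕ J × {x : P.V // P.c x ≠ a} → A
  | .inl _ => a
  | .inr x => P.c x.2

variable {P a ρ}

theorem amalgamMap_of_eq {g : J} {x : P.V} (h : P.c x = a) :
    P.amalgamMap a ρ g x = .inl (ρ g ⟨x, h⟩) := dif_pos h

theorem amalgamMap_of_ne {g : J} {x : P.V} (h : P.c x ≠ a) :
    P.amalgamMap a ρ g x = .inr (g, ⟨x, h⟩) := dif_neg h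

theorem amalgamPart_map (g : J) (x : P.V) :
    P.amalgamPart a (P.amalgamMap a ρ g x) = P.c x := by
  by_cases h : P.c x = a
  · rw [amalgamMap_of_eq h, h]; rfl
  · rw [amalgamMap_of_ne h]; rfl

theorem amalgamMap_injective (g : J) : Injective (P.amalgamMap a ρ g) := by
  intro x y hxy
  have hc : P.c x = P.c y := by rw [← amalgamPart_map (ρ := ρ) g x, hxy, amalgamPart_map]
  by_cases h : P.c x = a
  · rw [amalgamMap_of_eq h, amalgamMap_of_eq (hc ▸ h)] at hxy
    simpa using hxy
  · rw [amalgamMap_of_ne h, amalgamMap_of_ne (hc ▸ h)] at hxy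
    simpa using hxy

theorem part_eq_of_amalgamMap_eq {g h : J} (hgh : g ≠ h) {x y : P.V}
    (hxy : P.amalgamMap a ρ g x = P.amalgamMap a ρ h y) : P.c x = a := by
  by_contra hx
  have hc : P.c x = P.c y := by
    rw [← amalgamPart_map (ρ := ρ) g x, hxy, amalgamPart_map]
  rw [amalgamMap_of_ne hx, amalgamMap_of_ne (hc ▸ hx)] at hxy
  exact hgh (by simpa using congrArg (Sum.elim (fun _ => g) Prod.fst) hxy)

variable (P a ρ)

/-- The edges of the amalgam: the edge `i` in the copy `g`. -/
def amalgamEdge (i : J × P.I) : Set (Y ⊕ J × {x : P.V // P.c x ≠ a}) :=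
  P.amalgamMap a ρ i.1 '' P.edge i.2

variable {P a ρ}

/-- A copy of a hyperforest of `P` is a hyperforest of the amalgam. -/
theorem isHyperforest_amalgamMap_image (g : J) {S : Set P.V} (hS : IsHyperforest P.edge S) :
    IsHyperforest (P.amalgamEdge a ρ) (P.amalgamMap a ρ g '' S) := by
  refine hS.image (amalgamMap_injective g) (fun i => (g, i)) (fun _ => rfl) ?_
  rintro ⟨h, j⟩
  by_cases hgh : h = g
  · exact .inl ⟨j, by rw [hgh]⟩
  right
  -- an edge of another copy meets this copy only in part `a`
  rw [amalgamEdge]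
  rintro _ ⟨⟨_, ⟨x, rfl⟩, rfl⟩, x', hx'⟩ _ ⟨⟨_, ⟨y, rfl⟩, rfl⟩, y', hy'⟩
  have hx := part_eq_of_amalgamMap_eq hgh hx'.symm
  have hy := part_eq_of_amalgamMap_eq hgh hy'.symm
  rw [P.inj j (hx.trans hy.symm)]

variable [Finite J] [Finite Y]

/-- If the copies outside `D` meet `T` at most once, then they can be glued on one at a time, and
only sets confined to the copies in `D` need to be treated. -/
theorem isHyperforest_of_confined {r : ℕ} (hP : LocallyHyperforest P.edge r) {T : Set Y} (D : Set J)
    (hD : ∀ g, g ∉ D → (range (ρ g) ∩ T).Subsingleton)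
    (hbase : ∀ S : Set (Y ⊕ J × {x : P.V // P.c x ≠ a}), S.ncard ≤ r → Sum.inl ⁻¹' S = T →
      (∀ g x, Sum.inr (g, x) ∈ S → g ∈ D) → IsHyperforest (P.amalgamEdge a ρ) S)
    (S : Set (Y ⊕ J × {x : P.V // P.c x ≠ a})) (hS : S.ncard ≤ r) (hST : Sum.inl ⁻¹' S = T) :
    IsHyperforest (P.amalgamEdge a ρ) S := by
  induction hn : S.ncard using Nat.strong_induction_on generalizing S with
  | _ n ih =>
  by_cases hc : ∀ g x, Sum.inr (g, x) ∈ S → g ∈ D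
  · exact hbase S hS hST hc
  push Not at hc
  obtain ⟨g, x, hx, hg⟩ := hc
  set K : Set (Y ⊕ J × {x : P.V // P.c x ≠ a}) := range fun x => Sum.inr (g, x) with hK
  have hlt : (S \ K).ncard < S.ncard :=
    ncard_lt_ncard ⟨sdiff_subset, fun h => (h hx).2 ⟨x, rfl⟩⟩
  have hA : IsHyperforest (P.amalgamEdge a ρ) (S \ K) := by
    refine ih _ (hn ▸ hlt) _ (hlt.le.trans hS) ?_ rfl
    rw [← hST]
    ext y
    exact ⟨fun h => h.1, fun h => ⟨h, fun ⟨z, hz⟩ => by cases hz⟩⟩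
  have hB : IsHyperforest (P.amalgamEdge a ρ) (S ∩ range (P.amalgamMap a ρ g)) := by
    rw [← image_preimage_eq_inter_range]
    refine isHyperforest_amalgamMap_image g (hP _ (le_trans ?_ hS))
    rw [← ncard_image_of_injective _ (amalgamMap_injective (ρ := ρ) g)]
    exact ncard_le_ncard (image_preimage_subset _ _)
  have hU : S \ K ∪ S ∩ range (P.amalgamMap a ρ g) = S := by
    refine Subset.antisymm (union_subset sdiff_subset inter_subset_left) fun v hv => ?_
    by_cases hvK : v ∈ K
    · obtain ⟨z, rfl⟩ := hvK
      exact .inr ⟨hv, z, amalgamMap_of_ne z.2⟩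
    · exact .inl ⟨hv, hvK⟩
  rw [← hU]
  refine .glue ?_ (fun i => ?_) hA hB
  · have key : ∀ v ∈ S \ K ∩ (S ∩ range (P.amalgamMap a ρ g)),
        ∃ y ∈ range (ρ g) ∩ T, v = Sum.inl y := by
      rintro _ ⟨⟨hv, hvK⟩, -, z, rfl⟩
      by_cases hz : P.c z = a
      · rw [amalgamMap_of_eq hz] at hv ⊢
        exact ⟨_, ⟨⟨_, rfl⟩, hST ▸ hv⟩, rfl⟩
      · exact absurd ⟨⟨z, hz⟩, (amalgamMap_of_ne hz).symm⟩ hvK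
    intro v hv w hw
    obtain ⟨y, hy, rfl⟩ := key v hv
    obtain ⟨z, hz, rfl⟩ := key w hw
    rw [hD g hg hy hz]
  · rw [hU, amalgamEdge]
    by_cases hi : i.1 = g
    · exact .inr fun v hv => ⟨hv.2, hi ▸ image_subset_range _ _ hv.1⟩
    · left
      rintro _ ⟨⟨z, -, rfl⟩, hv⟩
      refine ⟨hv, ?_⟩
      rintro ⟨w, hw⟩
      have hw' : P.amalgamMap a ρ g w = P.amalgamMap a ρ i.1 z := by
        rw [amalgamMap_of_ne w.2]; exact hw
      exact w.2 (part_eq_of_amalgamMap_eq (Ne.symm hi) hw')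

/-- If the trace of a small vertex set on `Y` is a hyperforest, then so is the set: the copies of
`P` follow the tree structure of the trace. -/
theorem isHyperforest_of_trace {r : ℕ} (hP : LocallyHyperforest P.edge r) {T : Set Y}
    (hT : IsHyperforest (fun g => range (ρ g)) T)
    (S : Set (Y ⊕ J × {x : P.V // P.c x ≠ a})) (hS : S.ncard ≤ r) (hST : Sum.inl ⁻¹' S = T) :
    IsHyperforest (P.amalgamEdge a ρ) S := by
  induction hT generalizing S with
  | @subsingleton T h =>
    refine isHyperforest_of_confined hP ∅ (fun g _ => h.anti inter_subset_right) ?_ S hS hST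
    intro S hS hST hc
    refine .subsingleton ?_
    rintro (v | v) hv (w | w) hw
    · rw [h (hST ▸ hv : v ∈ T) (hST ▸ hw : w ∈ T)]
    all_goals first | exact (hc _ _ hv).elim | exact (hc _ _ hw).elim
  | @edge T g h h' =>
    refine isHyperforest_of_confined hP {g} h' ?_ S hS hST
    intro S hS hST hc
    have hsub : S ⊆ range (P.amalgamMap a ρ g) := by
      rintro (v | ⟨g', v⟩) hv
      · obtain ⟨x, rfl⟩ := h (hST ▸ hv : v ∈ T)
        exact ⟨x, amalgamMap_of_eq x.2⟩
      · obtain rfl : g' = g := hc _ _ hv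
        exact ⟨v, amalgamMap_of_ne v.2⟩
    rw [← image_preimage_eq_of_subset hsub]
    refine isHyperforest_amalgamMap_image g (hP _ (le_trans ?_ hS))
    rw [← ncard_image_of_injective _ (amalgamMap_injective (ρ := ρ) g)]
    exact ncard_le_ncard (image_preimage_subset _ _)
  | @glue A B h h' _ _ ihA ihB =>
    -- a copy goes to the side that contains the trace of its edge
    set p : J → Prop := fun g => range (ρ g) ∩ (A ∪ B) ⊆ A with hp
    set KA : Set (Y ⊕ J × {x : P.V // P.c x ≠ a}) := {v | Sum.elim (· ∈ A) (fun x => p x.1) v}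
    set KB : Set (Y ⊕ J × {x : P.V // P.c x ≠ a}) := {v | Sum.elim (· ∈ B) (fun x => ¬ p x.1) v}
    have hmem : ∀ y, Sum.inl y ∈ S ↔ y ∈ A ∪ B := fun y => by rw [← hST]; rfl
    have hU : S ∩ KA ∪ S ∩ KB = S := by
      rw [← inter_union_distrib_left]
      refine inter_eq_left.2 ?_
      rintro (v | v) hv
      · exact (hmem v).1 hv
      · exact em _
    have hA := ihA (S ∩ KA) ((ncard_le_ncard inter_subset_left).trans hS) (by
      ext y
      exact ⟨fun hy => hy.2, fun hy => ⟨(hmem y).2 (.inl hy), hy⟩⟩)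
    have hB := ihB (S ∩ KB) ((ncard_le_ncard inter_subset_left).trans hS) (by
      ext y
      exact ⟨fun hy => hy.2, fun hy => ⟨(hmem y).2 (.inr hy), hy⟩⟩)
    rw [← hU]
    refine .glue ?_ (fun i => ?_) hA hB
    · rintro (v | v) hv (w | w) hw
      · rw [h ⟨hv.1.2, hv.2.2⟩ ⟨hw.1.2, hw.2.2⟩]
      · exact (hw.2.2 hw.1.2).elim
      · exact (hv.2.2 hv.1.2).elim
      · exact (hv.2.2 hv.1.2).elim
    · rw [hU, amalgamEdge]
      by_cases hi : p i.1
      · left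
        rintro _ ⟨⟨z, -, rfl⟩, hv⟩
        refine ⟨hv, ?_⟩
        by_cases hz : P.c z = a
        · rw [amalgamMap_of_eq hz] at hv ⊢
          exact hi ⟨⟨_, rfl⟩, (hmem _).1 hv⟩
        · rw [amalgamMap_of_ne hz]
          exact hi
      · right
        rintro _ ⟨⟨z, -, rfl⟩, hv⟩
        refine ⟨hv, ?_⟩
        by_cases hz : P.c z = a
        · rw [amalgamMap_of_eq hz] at hv ⊢
          exact (h' i.1).resolve_left hi ⟨⟨_, rfl⟩, (hmem _).1 hv⟩
        · rw [amalgamMap_of_ne hz]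
          exact hi

variable (P a ρ)

/-- The partite amalgamation of `P` along part `a`: over every edge `ρ g` of a hypergraph on `Y`
one copy of `P` is placed, with its part `a` identified with that edge and otherwise disjoint from
all other copies. -/
noncomputable def amalgam : PartiteSystem N A where
  V := Y ⊕ J × {x : P.V // P.c x ≠ a}
  I := J × P.I
  finV := inferInstance
  finI := inferInstance
  φ i := (P.φ i.2).trans ⟨P.amalgamMap a ρ i.1, amalgamMap_injective i.1⟩
  c := P.amalgamPart a
  inj i x y hxy := P.inj i.2 (by simpa [amalgamPart_map] using hxy)

variable {P a ρ}

theorem amalgam_edge : (P.amalgam a ρ).edge = P.amalgamEdge a ρ :=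
  funext fun i => range_comp (P.amalgamMap a ρ i.1) (P.φ i.2)

/-- The step that gains local sparsity: a set of `r + 1` vertices either lies in the single part
`Y`, where it spans nothing, or has a trace of at most `r` vertices on `Y`. -/
theorem locallyHyperforest_amalgam {r : ℕ} (hP : LocallyHyperforest P.edge (r + 1))
    (hρ : LocallyHyperforest (fun g => range (ρ g)) r) :
    LocallyHyperforest (P.amalgam a ρ).edge (r + 1) := by
  rw [amalgam_edge]
  intro S hS
  by_cases hY : S ⊆ range Sum.inl
  · refine .of_fibers id S ?_ fun j => .subsingleton fun x hx y hy => hx.2.trans hy.2.symm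
    rintro i _ ⟨⟨_, ⟨x, rfl⟩, rfl⟩, hx⟩ _ ⟨⟨_, ⟨y, rfl⟩, rfl⟩, hy⟩
    have hc : ∀ x, P.amalgamMap a ρ i.1 x ∈ S → P.c x = a := by
      intro x hx
      obtain ⟨y, hy⟩ := hY hx
      rw [← amalgamPart_map (ρ := ρ) i.1 x, ← hy]
      rfl
    rw [P.inj i.2 ((hc _ hx).trans (hc _ hy).symm)]
  · refine isHyperforest_of_trace hP (hρ _ ?_) S hS rfl
    rw [← ncard_image_of_injective _ (Sum.inl_injective (β := J × {x : P.V // P.c x ≠ a}))]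
    have : (Sum.inl '' (Sum.inl ⁻¹' S) : Set (Y ⊕ J × {x : P.V // P.c x ≠ a})).ncard < S.ncard := by
      refine ncard_lt_ncard ⟨image_preimage_subset _ _, fun h => hY ?_⟩
      exact h.trans (image_subset_range _ _)
    omega

end Amalgam

end PartiteSystem

/-! ### Locally acyclic hypergraphs of large chromatic number -/

/-- For every finite set `N` and every number `k + 1` of colours there is a finite hypergraph, with
copies of `N` as edges, in which every set of at most `r` vertices spans a hyperforest and every
colouring of the vertices has a monochromatic edge. Zero colours are left out: without vertices
they would admit a colouring, so the existence of an edge could not be inferred from it. -/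
def ExistsSparseChromatic (r : ℕ) : Prop :=
  ∀ (N : Type) [Finite N] (k : ℕ), ∃ (V I : Type) (_ : Finite V) (_ : Finite I) (φ : I → N ↪ V),
    LocallyHyperforest (fun i => range (φ i)) r ∧
      ∀ χ : V → Fin (k + 1), ∃ i, ∀ x y, χ (φ i x) = χ (φ i y)

namespace PartiteSystem

variable {N A : Type}

/-- Amalgamating along the parts in a list one after the other forces a copy of `P` in which all of
these parts are monochromatic. -/
theorem exists_copy_monochromatic_parts {r : ℕ} (hr : ExistsSparseChromatic r) (k : ℕ)
    (P : PartiteSystem N A) (hP : LocallyHyperforest P.edge (r + 1)) (l : List A) :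
    ∃ Q : PartiteSystem N A, LocallyHyperforest Q.edge (r + 1) ∧
      ∀ χ : Q.V → Fin (k + 1), ∃ (ψ : P.V → Q.V) (ι : P.I → Q.I),
        (∀ i x, Q.φ (ι i) x = ψ (P.φ i x)) ∧ (∀ x, Q.c (ψ x) = P.c x) ∧
          ∀ x y, P.c x ∈ l → P.c x = P.c y → χ (ψ x) = χ (ψ y) := by
  induction l with
  | nil => exact ⟨P, hP, fun χ => ⟨id, id, by simp⟩⟩
  | cons a l ih =>
    obtain ⟨Q, hQ, hcopy⟩ := ih
    obtain ⟨Y, J, _, _, ρ, hρ, hmono⟩ := hr {x : Q.V // Q.c x = a} k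
    refine ⟨Q.amalgam a ρ, locallyHyperforest_amalgam hQ hρ, fun χ => ?_⟩
    obtain ⟨g, hg⟩ := hmono fun y => χ (Sum.inl y)
    obtain ⟨ψ, ι, hφ, hc, hl⟩ := hcopy fun x => χ (Q.amalgamMap a ρ g x)
    refine ⟨fun x => Q.amalgamMap a ρ g (ψ x), fun i => (g, ι i), fun i x => ?_, fun x => ?_,
      fun x y hx hxy => ?_⟩
    · exact congrArg (Q.amalgamMap a ρ g) (hφ i x)
    · exact (amalgamPart_map g (ψ x)).trans (hc x)
    · by_cases hxa : P.c x = a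
      · have h1 : Q.c (ψ x) = a := (hc x).trans hxa
        have h2 : Q.c (ψ y) = a := (hc y).trans (hxy.symm.trans hxa)
        simp only [amalgamMap_of_eq h1, amalgamMap_of_eq h2]
        exact hg _ _
      · exact hl x y ((List.mem_cons.1 hx).resolve_left hxa) hxy

/-- The disjoint union of one edge for every injection of `N` into the set of parts. -/
def disjointEdges (N A : Type) [Finite N] [Finite A] : PartiteSystem N A where
  V := (N ↪ A) × N
  I := N ↪ A
  finV := inferInstance
  finI := inferInstance
  φ i := ⟨fun x => (i, x), fun _ _ h => congrArg Prod.snd h⟩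
  c v := v.1 v.2
  inj i := i.injective

theorem isHyperforest_disjointEdges [Finite N] [Finite A] (S : Set ((N ↪ A) × N)) :
    IsHyperforest (disjointEdges N A).edge S := by
  have : Finite (disjointEdges N A).V := (disjointEdges N A).finV
  refine .of_fibers (V := (disjointEdges N A).V) (Prod.fst : (N ↪ A) × N → N ↪ A) S ?_ ?_
  · rintro i _ ⟨⟨x, rfl⟩, -⟩ _ ⟨⟨y, rfl⟩, -⟩
    rfl
  · intro i
    refine .edge i ?_ ?_
    · rintro ⟨j, x⟩ ⟨-, h⟩
      obtain rfl : j = i := h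
      exact ⟨x, rfl⟩
    · rintro j hj _ ⟨⟨x, rfl⟩, -, h⟩
      exact absurd h hj

end PartiteSystem

/-- Among `|N| * (k + 1) + 1` coloured points some injective copy of `N` is monochromatic. -/
theorem exists_embedding_monochromatic (N : Type) [Finite N] (k : ℕ)
    (χ : Fin (Nat.card N * (k + 1) + 1) → Fin (k + 1)) :
    ∃ f : N ↪ Fin (Nat.card N * (k + 1) + 1), ∀ x y, χ (f x) = χ (f y) := by
  classical
  have := Fintype.ofFinite N
  obtain ⟨y, -, hy⟩ := Finset.exists_lt_card_fiber_of_mul_lt_card_of_maps_to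
    (s := Finset.univ) (t := Finset.univ) (f := χ) (n := Nat.card N) (fun _ _ => Finset.mem_univ _)
    (by simp [mul_comm])
  obtain ⟨f⟩ : Nonempty (N ↪ {x // x ∈ Finset.univ.filter fun x => χ x = y}) := by
    refine Function.Embedding.nonempty_of_card_le ?_
    rw [Fintype.card_coe, ← Nat.card_eq_fintype_card]
    exact hy.le
  refine ⟨f.trans (Embedding.subtype _), fun u v => ?_⟩
  have h : ∀ u, χ (f u) = y := fun u => (Finset.mem_filter.1 (f u).2).2
  exact (h u).trans (h v).symm

theorem existsSparseChromatic (r : ℕ) : ExistsSparseChromatic r := by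
  induction r with
  | zero =>
    intro N _ k
    refine ⟨Fin (Nat.card N * (k + 1) + 1), N ↪ Fin (Nat.card N * (k + 1) + 1), inferInstance,
      inferInstance, id, fun S hS => .subsingleton ?_, exists_embedding_monochromatic N k⟩
    rw [(ncard_eq_zero).1 (Nat.le_zero.1 hS)]
    exact subsingleton_empty
  | succ r ih =>
    intro N _ k
    set A := Fin (Nat.card N * (k + 1) + 1)
    obtain ⟨Q, hQ, hcopy⟩ := PartiteSystem.exists_copy_monochromatic_parts ih k
      (PartiteSystem.disjointEdges N A)
      (fun S _ => PartiteSystem.isHyperforest_disjointEdges S) (List.finRange _)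
    refine ⟨Q.V, Q.I, Q.finV, Q.finI, Q.φ, hQ, fun χ => ?_⟩
    obtain ⟨ψ, ι, hφ, -, hl⟩ := hcopy χ
    -- all parts of the copy are monochromatic, which yields a colouring of the parts; a part that
    -- is empty in the copy receives an arbitrary colour
    have hpart : ∀ p : A, ∃ b : Fin (k + 1), ∀ x, (PartiteSystem.disjointEdges N A).c x = p →
        χ (ψ x) = b := by
      intro p
      by_cases hp : ∃ x, (PartiteSystem.disjointEdges N A).c x = p
      · obtain ⟨x, hx⟩ := hp
        exact ⟨χ (ψ x), fun y hy => hl y x (List.mem_finRange _) (hy.trans hx.symm)⟩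
      · exact ⟨0, fun x hx => absurd ⟨x, hx⟩ hp⟩
    choose d hd using hpart
    obtain ⟨f, hf⟩ := exists_embedding_monochromatic N k d
    refine ⟨ι f, fun x y => ?_⟩
    exact (congrArg χ (hφ f x)).trans <| (hd (f x) (f, x) rfl).trans <| (hf x y).trans <|
      ((congrArg χ (hφ f y)).trans (hd (f y) (f, y) rfl)).symm

/-! ### Tree-like graphs -/

/-- `IsTreeLike G b S` says that the subgraph of `G` induced by `S` is assembled from graphs on at
most `b` vertices by repeatedly gluing along at most one vertex. -/
inductive IsTreeLike {V : Type*} (G : SimpleGraph V) (b : ℕ) : Set V → Prop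
  | small {S : Set V} (hf : S.Finite) (h : S.ncard ≤ b) : IsTreeLike G b S
  | glue {A B : Set V} (h : (A ∩ B).Subsingleton)
      (h' : ∀ x ∈ A ∪ B, ∀ y ∈ A ∪ B, G.Adj x y → x ∈ A ∧ y ∈ A ∨ x ∈ B ∧ y ∈ B)
      (hA : IsTreeLike G b A) (hB : IsTreeLike G b B) : IsTreeLike G b (A ∪ B)

namespace IsTreeLike

variable {V V' : Type*} {G : SimpleGraph V} {G' : SimpleGraph V'} {b : ℕ} {S T : Set V}

theorem mono (h : IsTreeLike G b S) (hT : T ⊆ S) : IsTreeLike G b T := by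
  induction h generalizing T with
  | small hf h => exact .small (hf.subset hT) ((ncard_le_ncard hT hf).trans h)
  | @glue A B h h' _ _ ihA ihB =>
    have hU : T ∩ A ∪ T ∩ B = T := by rw [← inter_union_distrib_left, inter_eq_left.2 hT]
    rw [← hU]
    refine .glue (h.anti fun x hx => ⟨hx.1.2, hx.2.2⟩) ?_ (ihA inter_subset_right)
      (ihB inter_subset_right)
    rw [hU]
    intro x hx y hy hxy
    exact (h' x (hT hx) y (hT hy) hxy).imp (fun h => ⟨⟨hx, h.1⟩, hy, h.2⟩)
      fun h => ⟨⟨hx, h.1⟩, hy, h.2⟩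

theorem image (h : IsTreeLike G b S) (f : G ↪g G') : IsTreeLike G' b (f '' S) := by
  induction h with
  | small hf h => exact .small (hf.image f) ((ncard_image_le hf).trans h)
  | glue h h' _ _ ihA ihB =>
    rw [image_union]
    refine .glue ?_ ?_ ihA ihB
    · rw [← image_inter f.injective]
      exact h.image f
    · rw [← image_union]
      rintro _ ⟨x, hx, rfl⟩ _ ⟨y, hy, rfl⟩ hxy
      exact (h' x hx y hy (f.map_adj_iff.1 hxy)).imp
        (fun h => ⟨mem_image_of_mem f h.1, mem_image_of_mem f h.2⟩)
        fun h => ⟨mem_image_of_mem f h.1, mem_image_of_mem f h.2⟩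

theorem preimage {S : Set V'} (h : IsTreeLike G' b S) (f : G ↪g G') :
    IsTreeLike G b (f ⁻¹' S) := by
  induction h with
  | @small S hf h =>
    refine .small (hf.preimage f.injective.injOn) (le_trans ?_ h)
    rw [← ncard_image_of_injective _ f.injective]
    exact ncard_le_ncard (image_preimage_subset _ _) hf
  | glue h h' _ _ ihA ihB =>
    exact .glue (h.preimage f.injective)
      (fun x hx y hy hxy => h' _ hx _ hy (f.map_adj_iff.2 hxy)) ihA ihB

/-- Tree-like graphs with pieces on single vertices have no edges. -/
theorem not_adj (h : IsTreeLike G b S) (hb : b ≤ 1) {x y : V} (hx : x ∈ S) (hy : y ∈ S) :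
    ¬ G.Adj x y := by
  induction h with
  | small hf h => exact fun hxy => hxy.ne ((ncard_le_one hf).1 (h.trans hb) x hx y hy)
  | glue h h' _ _ ihA ihB =>
    intro hxy
    rcases h' x hx y hy hxy with ⟨hx, hy⟩ | ⟨hx, hy⟩
    · exact ihA hx hy hxy
    · exact ihB hx hy hxy

/-- A stable set can be chosen to meet all the pieces of a tree-like graph, so that its complement
is built from pieces with one vertex fewer. Membership of one vertex `v` in the stable set may
be prescribed, which makes the choices on two glued pieces compatible. -/
theorem exists_stable (h : IsTreeLike G (b + 1) S) (hb : 1 ≤ b) (v : V) (p : Prop) :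
    ∃ X ⊆ S, (v ∈ S → (v ∈ X ↔ p)) ∧ (∀ x ∈ X, ∀ y ∈ X, ¬ G.Adj x y) ∧
      IsTreeLike G b (S \ X) := by
  induction h generalizing v p with
  | @small S hf h =>
    -- the stable set has at most one vertex
    suffices ∃ X ⊆ S, (v ∈ S → (v ∈ X ↔ p)) ∧ X.Subsingleton ∧ (S \ X).ncard ≤ b by
      obtain ⟨X, hX, hv, hs, hc⟩ := this
      exact ⟨X, hX, hv, fun x hx y hy hxy => hxy.ne (hs hx hy), .small hf.sdiff hc⟩
    have hw : ∀ w ∈ S, (S \ {w}).ncard ≤ b := fun w hw => by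
      rw [ncard_sdiff_singleton_of_mem hw]
      omega
    by_cases hvp : v ∈ S ∧ p
    · exact ⟨{v}, by simpa using hvp.1, by simp [hvp.2], subsingleton_singleton, hw v hvp.1⟩
    · by_cases hex : ∃ w ∈ S, w ≠ v
      · obtain ⟨w, hwS, hwv⟩ := hex
        exact ⟨{w}, by simpa using hwS, fun hv => ⟨fun h => absurd h.symm hwv,
          fun h => absurd ⟨hv, h⟩ hvp⟩, subsingleton_singleton, hw w hwS⟩
      · push Not at hex
        refine ⟨∅, empty_subset _, fun hv => ⟨False.elim, fun h => absurd ⟨hv, h⟩ hvp⟩,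
          subsingleton_empty, ?_⟩
        rw [sdiff_empty]
        exact ((ncard_le_one hf).2 fun x hx y hy => (hex x hx).trans (hex y hy).symm).trans hb
  | @glue A B h h' hA hB ihA ihB =>
    -- it suffices to find choices on both sides that agree on the common vertex
    suffices ∃ X ⊆ A, ∃ Y ⊆ B, (∀ u ∈ A ∩ B, (u ∈ X ↔ u ∈ Y)) ∧ (v ∈ A → (v ∈ X ↔ p)) ∧
        (v ∈ B → (v ∈ Y ↔ p)) ∧ (∀ x ∈ X, ∀ y ∈ X, ¬ G.Adj x y) ∧
        (∀ x ∈ Y, ∀ y ∈ Y, ¬ G.Adj x y) ∧ IsTreeLike G b (A \ X) ∧ IsTreeLike G b (B \ Y) by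
      obtain ⟨X, hX, Y, hY, hu, hvA, hvB, hsX, hsY, htX, htY⟩ := this
      have hXA : ∀ x ∈ X ∪ Y, x ∈ A → x ∈ X := fun x hx hxA =>
        hx.elim id fun hx => (hu x ⟨hxA, hY hx⟩).2 hx
      have hYB : ∀ x ∈ X ∪ Y, x ∈ B → x ∈ Y := fun x hx hxB =>
        hx.elim (fun hx => (hu x ⟨hX hx, hxB⟩).1 hx) id
      have hsub : X ∪ Y ⊆ A ∪ B := union_subset_union hX hY
      refine ⟨X ∪ Y, hsub, ?_, ?_, ?_⟩
      · rintro (hv | hv)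
        · exact ⟨fun hvX => (hvA hv).1 (hXA v hvX hv), fun hp => .inl ((hvA hv).2 hp)⟩
        · exact ⟨fun hvY => (hvB hv).1 (hYB v hvY hv), fun hp => .inr ((hvB hv).2 hp)⟩
      · intro x hx y hy hxy
        rcases h' x (hsub hx) y (hsub hy) hxy with hA | hB
        · exact hsX x (hXA x hx hA.1) y (hXA y hy hA.2) hxy
        · exact hsY x (hYB x hx hB.1) y (hYB y hy hB.2) hxy
      · have hU : (A ∪ B) \ (X ∪ Y) = A \ X ∪ B \ Y := by
          ext x
          constructor
          · rintro ⟨hx | hx, hn⟩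
            · exact .inl ⟨hx, fun h => hn (.inl h)⟩
            · exact .inr ⟨hx, fun h => hn (.inr h)⟩
          · rintro (⟨hx, hn⟩ | ⟨hx, hn⟩)
            · exact ⟨.inl hx, fun h => hn (hXA x h hx)⟩
            · exact ⟨.inr hx, fun h => hn (hYB x h hx)⟩
        rw [hU]
        refine .glue (h.anti fun x hx => ⟨hx.1.1, hx.2.1⟩) ?_ htX htY
        rw [← hU]
        intro x hx y hy hxy
        exact (h' x hx.1 y hy.1 hxy).imp
          (fun h => ⟨⟨h.1, fun hn => hx.2 (.inl hn)⟩, h.2, fun hn => hy.2 (.inl hn)⟩)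
          fun h => ⟨⟨h.1, fun hn => hx.2 (.inr hn)⟩, h.2, fun hn => hy.2 (.inr hn)⟩
    obtain ⟨u, hu⟩ : ∃ u, A ∩ B ⊆ {u} := by
      rcases h.eq_empty_or_singleton with h | ⟨u, h⟩
      · exact ⟨v, by simp [h]⟩
      · exact ⟨u, h.subset⟩
    by_cases hv : v ∈ A
    · obtain ⟨X, hX, hvX, hsX, htX⟩ := ihA v p
      obtain ⟨Y, hY, huY, hsY, htY⟩ := ihB u (u ∈ X)
      have hag : ∀ w ∈ A ∩ B, (w ∈ X ↔ w ∈ Y) := by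
        intro w hw
        obtain rfl : w = u := hu hw
        exact (huY hw.2).symm
      exact ⟨X, hX, Y, hY, hag, hvX, fun hvB => (hag v ⟨hv, hvB⟩).symm.trans (hvX hv), hsX, hsY,
        htX, htY⟩
    · obtain ⟨Y, hY, hvY, hsY, htY⟩ := ihB v p
      obtain ⟨X, hX, huX, hsX, htX⟩ := ihA u (u ∈ Y)
      have hag : ∀ w ∈ A ∩ B, (w ∈ X ↔ w ∈ Y) := by
        intro w hw
        obtain rfl : w = u := hu hw
        exact huX hw.1
      exact ⟨X, hX, Y, hY, hag, fun hvA => absurd hvA hv, hvY, hsX, hsY, htX, htY⟩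

/-- The disjoint union of two tree-like graphs is tree-like. -/
theorem sum (h : IsTreeLike G b univ) (h' : IsTreeLike G' b univ) :
    IsTreeLike (G ⊕g G') b univ := by
  rw [← range_inl_union_range_inr]
  refine .glue ?_ ?_ ?_ ?_
  · rw [range_inl_inter_range_inr]
    exact subsingleton_empty
  · rintro (x | x) - (y | y) - hxy
    · exact .inl ⟨⟨x, rfl⟩, y, rfl⟩
    · simp at hxy
    · simp at hxy
    · exact .inr ⟨⟨x, rfl⟩, y, rfl⟩
  · simpa using h.image (SimpleGraph.Embedding.sumInl (G := G) (H := G'))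
  · simpa using h'.image (SimpleGraph.Embedding.sumInr (G := G) (H := G'))

end IsTreeLike

/-- A graph with an edge is not an induced subgraph of a stable set. -/
theorem indFree_induce_of_stable {U : Type u} {V : Type v} {F : SimpleGraph U} {G : SimpleGraph V}
    (hF : F.edgeSet.Nonempty) {X : Set V} (hX : ∀ x ∈ X, ∀ y ∈ X, ¬ G.Adj x y) :
    IndFree F (G.induce X) := by
  rintro ⟨f⟩
  obtain ⟨e, he⟩ := hF
  induction e with
  | _ x y => exact hX _ (f x).2 _ (f y).2 (f.map_adj_iff.2 he)

/-- Tree-likeness passes to induced subgraphs, so its failure for `F` excludes `F`. -/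
theorem indFree_induce_of_isTreeLike {U : Type u} {V : Type v} {F : SimpleGraph U}
    {G : SimpleGraph V} {b : ℕ} {X : Set V} (hX : IsTreeLike G b X) (hF : ¬ IsTreeLike F b univ) :
    IndFree F (G.induce X) := by
  rintro ⟨f⟩
  refine hF ?_
  convert hX.preimage (f.trans (SimpleGraph.Embedding.induce X)) using 1
  exact (eq_univ_of_forall fun x => (f x).2).symm

/-- If all pieces have at most `b + 1` vertices, while `L` or `M` needs pieces with more than `b`
vertices, then a stable set and its complement show that the graph is `{L, M}`-split. -/
theorem isSplitPair_of_isTreeLike {U W : Type u} {V : Type v} {L : SimpleGraph U}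
    {M : SimpleGraph W} {G : SimpleGraph V} (hL : L.edgeSet.Nonempty) (hM : M.edgeSet.Nonempty)
    {b : ℕ} (hb : 1 ≤ b) (hG : IsTreeLike G (b + 1) univ)
    (hLM : ¬ (IsTreeLike L b univ ∧ IsTreeLike M b univ)) : IsSplitPair L M G := by
  obtain ⟨X, hs, ht⟩ : ∃ X : Set V, (∀ x ∈ X, ∀ y ∈ X, ¬ G.Adj x y) ∧ IsTreeLike G b Xᶜ := by
    rcases isEmpty_or_nonempty V with hV | ⟨⟨v⟩⟩
    · exact ⟨∅, fun x => isEmptyElim x, .small (toFinite _) (by simp [eq_empty_of_isEmpty])⟩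
    · obtain ⟨X, -, -, hs, ht⟩ := hG.exists_stable hb v True
      exact ⟨X, hs, compl_eq_univ_sdiff X ▸ ht⟩
  by_cases h : IsTreeLike L b univ
  · exact ⟨X, Xᶜ, union_compl_self X, indFree_induce_of_stable hL hs,
      indFree_induce_of_isTreeLike ht fun h' => hLM ⟨h, h'⟩⟩
  · exact ⟨Xᶜ, X, compl_union_self X, indFree_induce_of_isTreeLike ht h,
      indFree_induce_of_stable hM hs⟩

/-! ### Placing a graph on the edges of a hypergraph -/

/-- The graph on `V` obtained by placing a copy of `H` on every edge `φ i`. -/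
def placeOnEdges {I N V : Type*} (H : SimpleGraph N) (φ : I → N ↪ V) : SimpleGraph V :=
  ⨆ i, H.map (φ i)

theorem placeOnEdges_adj {I N V : Type*} {H : SimpleGraph N} {φ : I → N ↪ V} {x y : V} :
    (placeOnEdges H φ).Adj x y ↔ ∃ i a b, H.Adj a b ∧ φ i a = x ∧ φ i b = y := by
  simp [placeOnEdges, SimpleGraph.map_adj]

section Place

variable {I N V : Type*} {H : SimpleGraph N} {φ : I → N ↪ V}

/-- If distinct edges share at most one vertex, then each edge induces a copy of `H`. -/
theorem adj_of_placeOnEdges_adj {r : ℕ} (hφ : LocallyHyperforest (fun i => range (φ i)) r)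
    (hr : 2 ≤ r) {i : I} {a b : N} (h : (placeOnEdges H φ).Adj (φ i a) (φ i b)) : H.Adj a b := by
  obtain ⟨j, a', b', hab, ha, hb⟩ := placeOnEdges_adj.1 h
  by_cases hij : i = j
  · subst hij
    rwa [← (φ i).injective ha, ← (φ i).injective hb]
  · have hS := hφ {φ i a, φ i b} (le_trans (by
      simpa using ncard_insert_le (φ i a) {φ i b}) hr)
    exact absurd (hS.subsingleton_inter hij ⟨⟨⟨a, rfl⟩, a', ha⟩, by simp⟩
      ⟨⟨⟨b, rfl⟩, b', hb⟩, by simp⟩) h.ne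

/-- Each edge carries an induced copy of `H`. -/
def edgeEmbedding {r : ℕ} (hφ : LocallyHyperforest (fun i => range (φ i)) r) (hr : 2 ≤ r) (i : I) :
    H ↪g placeOnEdges H φ where
  toEmbedding := φ i
  map_rel_iff' := ⟨adj_of_placeOnEdges_adj hφ hr,
    fun h => placeOnEdges_adj.2 ⟨i, _, _, h, rfl, rfl⟩⟩

variable [Finite V]

/-- Placing a tree-like graph on the edges of a hyperforest gives a tree-like graph. -/
theorem isTreeLike_placeOnEdges {r b : ℕ} (hφ : LocallyHyperforest (fun i => range (φ i)) r)
    (hr : 2 ≤ r) (hb : 1 ≤ b) (hH : IsTreeLike H b univ) {S : Set V}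
    (hS : IsHyperforest (fun i => range (φ i)) S) : IsTreeLike (placeOnEdges H φ) b S := by
  induction hS with
  | subsingleton h => exact .small (toFinite _) ((ncard_le_one_iff_subsingleton.2 h).trans hb)
  | edge i h _ =>
    have := hH.image (edgeEmbedding hφ hr i)
    rw [image_univ] at this
    exact this.mono h
  | glue h h' _ _ ihA ihB =>
    refine .glue h ?_ ihA ihB
    intro x hx y hy hxy
    obtain ⟨i, a, c, -, rfl, rfl⟩ := placeOnEdges_adj.1 hxy
    exact (h' i).imp (fun h => ⟨h ⟨⟨a, rfl⟩, hx⟩, h ⟨⟨c, rfl⟩, hy⟩⟩)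
      fun h => ⟨h ⟨⟨a, rfl⟩, hx⟩, h ⟨⟨c, rfl⟩, hy⟩⟩

end Place

/-- If every colouring of `G` has a monochromatic induced copy of a graph `H` that contains both `L`
and `M`, then `G` has no `({L, M}, k)`-partition. A part with a single vertex is no help, since `L`
has an edge. -/
theorem not_admitsPartition {U W : Type u} {N I V : Type} {L : SimpleGraph U} {M : SimpleGraph W}
    (hL : L.edgeSet.Nonempty) {H : SimpleGraph N} (fL : L ↪g H) (fM : M ↪g H)
    {G : SimpleGraph V} (φ : I → H ↪g G) {k : ℕ}
    (hφ : ∀ χ : V → Fin (k + 1), ∃ i, ∀ x y, χ (φ i x) = χ (φ i y)) :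
    ¬ AdmitsPartition {⟨U, L⟩, ⟨W, M⟩} k G := by
  rintro ⟨X, hX, hfree⟩
  have hcov : ∀ v, ∃ i, v ∈ X i := fun v => mem_iUnion.1 (hX ▸ mem_univ v)
  choose χ hχ using hcov
  obtain ⟨i, hi⟩ := hφ fun v => (χ v).castSucc
  obtain ⟨e, he⟩ := hL
  induction e with
  | _ u w =>
  set j := χ (φ i (fL u)) with hj
  have hmem : ∀ x, φ i x ∈ X j := fun x => by
    have : χ (φ i x) = j := Fin.castSucc_injective _ (hi x _)
    exact this ▸ hχ (φ i x)
  let ψ : H ↪g G.induce (X j) :=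
    ⟨⟨fun x => ⟨φ i x, hmem x⟩, fun x y h => (φ i).injective (congrArg Subtype.val h)⟩,
      (φ i).map_rel_iff'⟩
  rcases hfree j with h | ⟨F, hF, h⟩
  · obtain ⟨v, hv⟩ := ncard_eq_one.1 h
    have h1 : φ i (fL u) = v := by simpa [hv] using hmem (fL u)
    have h2 : φ i (fL w) = v := by simpa [hv] using hmem (fL w)
    exact he.ne (fL.injective ((φ i).injective (h1.trans h2.symm)))
  · rcases hF with rfl | rfl
    · exact h ⟨fL.trans ψ⟩
    · exact h ⟨fM.trans ψ⟩

theorem mainTheorem4 {U W : Type u} [Finite U] [Finite W]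
    (L : SimpleGraph U) (M : SimpleGraph W)
    (hL : L.edgeSet.Nonempty) (hM : M.edgeSet.Nonempty) (r k : ℕ) :
    ∃ (V : Type) (_ : Fintype V) (G : SimpleGraph V),
      (∀ S : Finset V, S.card ≤ r → IsSplitPair L M (G.induce (S : Set V))) ∧
      ¬ AdmitsPartition {⟨U, L⟩, ⟨W, M⟩} k G := by
  classical
  -- the least piece size for which both graphs are tree-like
  have hex : ∃ b, IsTreeLike L b univ ∧ IsTreeLike M b univ :=
    ⟨max (univ : Set U).ncard (univ : Set W).ncard, .small (toFinite _) (le_max_left _ _),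
      .small (toFinite _) (le_max_right _ _)⟩
  obtain ⟨b, hb, ⟨hLb, hMb⟩, hmin⟩ : ∃ b, 1 ≤ b ∧
      (IsTreeLike L (b + 1) univ ∧ IsTreeLike M (b + 1) univ) ∧
      ¬ (IsTreeLike L b univ ∧ IsTreeLike M b univ) := by
    have h2 : 2 ≤ Nat.find hex := by
      by_contra h
      obtain ⟨e, he⟩ := hL
      induction e with
      | _ x y => exact (Nat.find_spec hex).1.not_adj (by omega) (mem_univ x) (mem_univ y) he
    refine ⟨Nat.find hex - 1, by omega, ?_, Nat.find_min hex (by omega)⟩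
    rw [Nat.sub_add_cancel (by omega)]
    exact Nat.find_spec hex
  -- a copy of the disjoint union of `L` and `M` in the lowest universe
  obtain ⟨n, ⟨σ⟩⟩ := Finite.exists_equiv_fin (U ⊕ W)
  set H : SimpleGraph (Fin n) := (L ⊕g M).comap σ.symm
  let τ : H ≃g (L ⊕g M) := SimpleGraph.Iso.comap σ.symm _
  have hH : IsTreeLike H (b + 1) univ := (hLb.sum hMb).preimage τ.toEmbedding
  obtain ⟨V, I, _, _, φ, hφ, hχ⟩ := existsSparseChromatic (max r 2) (Fin n) k
  have hr : 2 ≤ max r 2 := le_max_right _ _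
  refine ⟨V, Fintype.ofFinite V, placeOnEdges H φ, fun S hS => ?_, ?_⟩
  · have hST : IsTreeLike (placeOnEdges H φ) (b + 1) S :=
      isTreeLike_placeOnEdges hφ hr (by omega) hH
        (hφ _ (by rw [ncard_coe_finset]; exact hS.trans (le_max_left _ _)))
    refine isSplitPair_of_isTreeLike hL hM hb ?_ hmin
    convert hST.preimage (SimpleGraph.Embedding.induce (S : Set V)) using 1
    exact (eq_univ_of_forall fun x => x.2).symm
  · exact not_admitsPartition hL (SimpleGraph.Embedding.sumInl.trans τ.symm.toEmbedding)
      (SimpleGraph.Embedding.sumInr.trans τ.symm.toEmbedding) (edgeEmbedding hφ hr) hχ
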